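/- Let $V$ be the complex vector space (of dimension $15$) of the $1$-forms $\omega=a\,\mathrm dX+b\,\mathrm dY+c\,\mathrm dZ$ on $\mathbb C^3$ with $a,b,c\in\mathbb C[X,Y,Z]$ homogeneous of degree $3$ satisfying $aX+bY+cZ=0$. Let $\mathscr F(2;2)\subset\mathbb P(V)=\mathbb P^{14}(\mathbb C)$ be the set of classes $[\omega]$ such that $a,b,c$ have no non-constant common factor, i.e. the set of holomorphic foliations of degree $2$ on $\mathbb P^2(\mathbb C)$, with the topology induced by the usual topology of $\mathbb P^{14}(\mathbb C)$. The group $\mathrm{Aut}(\mathbb P^2(\mathbb C))=\mathrm{PGL}_3(\mathbb C)$ acts on $\mathscr F(2;2)$ by linear changes of coordinates; denote by $\mathcal O(\mathcal F)$ the orbit of $\mathcal F$ and by $\overline{\mathcal O(\mathcal F)}$ its closure in $\mathscr F(2;2)$. Let $\mathcal F_1,\mathcal F_2,\mathcal F_3,\mathcal F_5\in\mathscr F(2;2)$ be the foliations given in the affine chart $Z=1$, with $x=X/Z$, $y=Y/Z$, by $$\omega_1=x^2\mathrm dx+y^2(x\,\mathrm dy-y\,\mathrm dx),\qquad \omega_2=x^2\mathrm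 dx+(x+y^2)(x\,\mathrm dy-y\,\mathrm dx),$$ $$\omega_3=xy\,\mathrm dx+(x^2+y^2)(x\,\mathrm dy-y\,\mathrm dx),\qquad \omega_5=x^2\mathrm dy+y^2(x\,\mathrm dy-y\,\mathrm dx).$$ Then: 1. The orbits $\mathcal O(\mathcal F_1)$ and $\mathcal O(\mathcal F_5)$ are closed in $\mathscr F(2;2)$. 2. For $i=2,3$ one has $\overline{\mathcal O(\mathcal F_i)}=\mathcal O(\mathcal F_i)\cup\mathcal O(\mathcal F_1)$. -/

import Mathlib

open scoped LinearAlgebra.Projectivization MatrixGroups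
open MvPolynomial

noncomputable section

namespace PlaneFoliation

/-! ### Homogeneous 1-forms on `ℂ³` annihilated by the radial field -/

/-- The polynomial ring `ℂ[X, Y, Z]` (variables indexed by `0, 1, 2`). -/
abbrev Poly : Type := MvPolynomial (Fin 3) ℂ

/-- The polynomial 1-forms `a dX + b dY + c dZ` on `ℂ³` (recorded as `(a, b, c)`) with `a, b, c`
homogeneous of degree `N + 1` and `X a + Y b + Z c = 0`. -/
def eulerForms (N : ℕ) : Submodule ℂ (Fin 3 → Poly) where
  carrier := {w | (∀ i, (w i).IsHomogeneous (N + 1)) ∧ ∑ i, X i * w i = 0}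
  add_mem' := by
    rintro v w ⟨hv, hv'⟩ ⟨hw, hw'⟩
    refine ⟨fun i => (hv i).add (hw i), ?_⟩
    simp only [Pi.add_apply, mul_add, Finset.sum_add_distrib, hv', hw', add_zero]
  zero_mem' := ⟨fun i => isHomogeneous_zero _ _ _, by simp⟩
  smul_mem' := by
    rintro c v ⟨hv, hv'⟩
    refine ⟨fun i => (homogeneousSubmodule (Fin 3) ℂ (N + 1)).smul_mem c (hv i), ?_⟩
    simp only [Pi.smul_apply, mul_smul_comm, ← Finset.smul_sum, hv', smul_zero]

/-- The finite dimensional vector space of the 1-forms above. -/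
def Form (N : ℕ) : Type := eulerForms N

instance (N : ℕ) : AddCommGroup (Form N) := inferInstanceAs (AddCommGroup (eulerForms N))

instance (N : ℕ) : Module ℂ (Form N) := inferInstanceAs (Module ℂ (eulerForms N))

/-- The coefficients `(a, b, c)` of a form. -/
def Form.comp {N : ℕ} (w : Form N) : Fin 3 → Poly := w.1

/-- The usual topology of a finite dimensional complex vector space: that of convergence of the
coefficients. -/
instance (N : ℕ) : TopologicalSpace (Form N) :=
  TopologicalSpace.induced
    (fun (w : Form N) (q : Fin 3 × (Fin 3 →₀ ℕ)) => coeff q.2 (w.comp q.1)) inferInstance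

/-- The usual (quotient) topology of the projective space of forms. -/
instance (N : ℕ) : TopologicalSpace (ℙ ℂ (Form N)) :=
  TopologicalSpace.coinduced (Projectivization.mk' ℂ) inferInstance

/-! ### Linear changes of coordinates -/

/-- The substitution `f ↦ f (A • (X, Y, Z))`. -/
def subst (A : Matrix (Fin 3) (Fin 3) ℂ) : Poly →ₐ[ℂ] Poly :=
  aeval fun i => ∑ k, C (A i k) * X k

lemma subst_X (A : Matrix (Fin 3) (Fin 3) ℂ) (i : Fin 3) :
    subst A (X i) = ∑ k, C (A i k) * X k := by simp [subst]

lemma subst_C (A : Matrix (Fin 3) (Fin 3) ℂ) (c : ℂ) : subst A (C c) = C c := by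
  simp [subst]

lemma subst_one (p : Poly) : subst 1 p = p := by
  have h : subst 1 = AlgHom.id ℂ Poly := by
    apply MvPolynomial.algHom_ext
    intro i
    simp [subst_X, Matrix.one_apply, Finset.sum_ite_eq]
  rw [h]; rfl

lemma subst_mul (A B : Matrix (Fin 3) (Fin 3) ℂ) (p : Poly) :
    subst (A * B) p = subst B (subst A p) := by
  have h : subst (A * B) = (subst B).comp (subst A) := by
    apply MvPolynomial.algHom_ext
    intro i
    simp only [AlgHom.comp_apply, subst_X, map_sum, map_mul, subst_C, Matrix.mul_apply,
      Finset.sum_mul, Finset.mul_sum]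
    rw [Finset.sum_comm]
    simp only [mul_assoc]
  rw [h]; rfl

lemma isHomogeneous_subst (A : Matrix (Fin 3) (Fin 3) ℂ) {p : Poly} {n : ℕ}
    (hp : p.IsHomogeneous n) : (subst A p).IsHomogeneous n := by
  have h := hp.aeval (fun i => ∑ k, C (A i k) * X k : Fin 3 → Poly) (n := 1) (fun i =>
    IsHomogeneous.sum _ _ _ fun k _ => by
      simpa using (isHomogeneous_C (Fin 3) (A i k)).mul (isHomogeneous_X ℂ k))
  simpa [subst] using h

/-- The pull-back `A^* ω` of the 1-form `ω = ∑ᵢ ωᵢ dXᵢ` by the linear map `A`: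
its `j`-th coefficient is `∑ᵢ (ωᵢ ∘ A) ∂(A X)ᵢ / ∂Xⱼ`. -/
def pullback {N : ℕ} (A : Matrix (Fin 3) (Fin 3) ℂ) (w : Form N) : Form N :=
  ⟨fun j => ∑ i, C (A i j) * subst A (w.comp i), fun j =>
    IsHomogeneous.sum _ _ _ fun i _ => by
      simpa using (isHomogeneous_C (Fin 3) (A i j)).mul
        (isHomogeneous_subst A (p := w.comp i) (w.2.1 i)), by
    have h : subst A (∑ i, X i * w.comp i) = 0 := by
      have := w.2.2
      rw [show (∑ i, X i * w.comp i) = 0 from this, map_zero]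
    simp only [map_sum, map_mul, subst_X] at h
    rw [← h]
    simp only [Finset.mul_sum, Finset.sum_mul]
    rw [Finset.sum_comm]
    exact Finset.sum_congr rfl fun i _ => Finset.sum_congr rfl fun j _ => by ring⟩

lemma Form.ext {N : ℕ} {v w : Form N} (h : ∀ i, v.comp i = w.comp i) : v = w :=
  Subtype.ext (funext h)

lemma Form.comp_add {N : ℕ} (v w : Form N) (i : Fin 3) :
    (v + w).comp i = v.comp i + w.comp i := rfl

lemma Form.comp_smul {N : ℕ} (c : ℂ) (w : Form N) (i : Fin 3) :
    (c • w).comp i = c • w.comp i := rfl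

lemma Form.comp_zero {N : ℕ} (i : Fin 3) : (0 : Form N).comp i = 0 := rfl

lemma comp_pullback {N : ℕ} (A : Matrix (Fin 3) (Fin 3) ℂ) (w : Form N) (j : Fin 3) :
    (pullback A w).comp j = ∑ i, C (A i j) * subst A (w.comp i) := rfl

lemma pullback_one {N : ℕ} (w : Form N) : pullback 1 w = w := by
  refine Form.ext fun j => ?_
  simp [comp_pullback, subst_one, Matrix.one_apply]

lemma pullback_mul {N : ℕ} (A B : Matrix (Fin 3) (Fin 3) ℂ) (w : Form N) :
    pullback (A * B) w = pullback B (pullback A w) := by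
  refine Form.ext fun j => ?_
  simp only [comp_pullback, map_sum, map_mul, subst_C, Matrix.mul_apply, subst_mul,
    Finset.sum_mul, Finset.mul_sum]
  rw [Finset.sum_comm]
  exact Finset.sum_congr rfl fun i _ => Finset.sum_congr rfl fun j _ => by ring

lemma pullback_scalar {N : ℕ} (c : ℂ) (w : Form N) :
    pullback (Matrix.scalar (Fin 3) c) w = c ^ (N + 2) • w := by
  have hs : ∀ i, subst (Matrix.scalar (Fin 3) c) (w.comp i) = c ^ (N + 1) • w.comp i := by
    intro i
    have h1 : subst (Matrix.scalar (Fin 3) c) (w.comp i)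
        = aeval (fun k => C c * X k : Fin 3 → Poly) (w.comp i) := by
      unfold subst
      congr 2
      funext k
      rw [Finset.sum_eq_single k]
      · simp
      · intro b _ hb
        simp [Ne.symm hb]
      · simp
    have h2 : (w.comp i).IsHomogeneous (N + 1) := w.2.1 i
    rw [h1]
    conv_rhs => rw [(w.comp i).as_sum]
    conv_lhs => rw [(w.comp i).as_sum]
    rw [map_sum, Finset.smul_sum]
    refine Finset.sum_congr rfl fun d hd => ?_
    have hdeg : d.degree = N + 1 := by
      have := h2 (mem_support_iff.mp hd)
      rwa [Finsupp.degree_eq_weight_one]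
    rw [aeval_monomial, Finsupp.prod]
    simp only [mul_pow, Finset.prod_mul_distrib, Finset.prod_pow_eq_pow_sum]
    rw [show ∑ k ∈ d.support, d k = N + 1 from hdeg, smul_monomial, monomial_eq, Finsupp.prod,
      algebraMap_eq, smul_eq_mul, C_mul, C_pow]
    ring
  refine Form.ext fun j => ?_
  rw [comp_pullback, Form.comp_smul]
  simp only [hs]
  rw [Finset.sum_eq_single j]
  · simp [smul_eq_C_mul, pow_succ]
    ring
  · intro b _ hb
    simp [hb]
  · simp

/-- `GL₃(ℂ)` acts on the forms by push-forward, `g • ω = (g⁻¹)^* ω`. -/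
instance (N : ℕ) : DistribMulAction (GL (Fin 3) ℂ) (Form N) where
  smul g w := pullback (g⁻¹).1 w
  one_smul w := by
    change pullback ((1 : GL (Fin 3) ℂ)⁻¹).1 w = w
    simp [pullback_one]
  mul_smul g h w := by
    change pullback ((g * h)⁻¹).1 w = pullback (g⁻¹).1 (pullback (h⁻¹).1 w)
    rw [mul_inv_rev, Units.val_mul, pullback_mul]
  smul_zero g := Form.ext fun j => by
    change (pullback (g⁻¹).1 (0 : Form N)).comp j = 0
    simp [comp_pullback, Form.comp_zero]
  smul_add g v w := Form.ext fun j => by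
    change (pullback (g⁻¹).1 (v + w)).comp j
      = (pullback (g⁻¹).1 v).comp j + (pullback (g⁻¹).1 w).comp j
    simp only [comp_pullback, Form.comp_add, map_add, mul_add, Finset.sum_add_distrib]

lemma smul_def {N : ℕ} (g : GL (Fin 3) ℂ) (w : Form N) : g • w = pullback (g⁻¹).1 w := rfl

instance (N : ℕ) : SMulCommClass (GL (Fin 3) ℂ) ℂ (Form N) where
  smul_comm g c w := Form.ext fun j => by
    simp only [smul_def, comp_pullback, Form.comp_smul, map_smul, mul_smul_comm, Finset.smul_sum]

/-! ### Foliations of degree `N` on the projective plane -/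

/-- The coefficients have no common component (no common non-constant factor). -/
def Form.NoCommonFactor {N : ℕ} (w : Form N) : Prop :=
  ∀ d : Poly, (∀ i, d ∣ w.comp i) → IsUnit d

lemma Form.NoCommonFactor.ne_zero {N : ℕ} {w : Form N} (h : w.NoCommonFactor) : w ≠ 0 := by
  rintro rfl
  have := h 0 fun i => by rw [Form.comp_zero]
  simp at this

lemma Form.NoCommonFactor.smul {N : ℕ} {w : Form N} (h : w.NoCommonFactor)
    (g : GL (Fin 3) ℂ) : (g • w).NoCommonFactor := by
  intro d hd
  have h1 : IsUnit (subst g.1 d) := by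
    refine h _ fun j => ?_
    have hw : w = pullback g.1 (g • w) := by
      rw [smul_def, ← pullback_mul, ← Units.val_mul, inv_mul_cancel, Units.val_one, pullback_one]
    rw [hw, comp_pullback]
    exact Finset.dvd_sum fun i _ => Dvd.dvd.mul_left (map_dvd _ (hd i)) _
  have h2 := h1.map (subst (g⁻¹).1)
  rwa [← subst_mul, ← Units.val_mul, mul_inv_cancel, Units.val_one, subst_one] at h2

/-- The set `𝓕(2; N)` of the foliations of degree `N` on `ℙ²(ℂ)`, as a subspace (with the
induced topology) of the projective space of forms. -/
abbrev Foliation (N : ℕ) : Type := {p : ℙ ℂ (Form N) // p.rep.NoCommonFactor}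

lemma noCommonFactor_rep_mk {N : ℕ} (w : Form N) (hw : w ≠ 0) :
    (Projectivization.mk ℂ w hw).rep.NoCommonFactor ↔ w.NoCommonFactor := by
  obtain ⟨a, ha⟩ := Projectivization.exists_smul_eq_mk_rep ℂ w hw
  rw [← ha]
  refine forall_congr' fun d => ?_
  have h : ∀ i, d ∣ (a • w).comp i ↔ d ∣ w.comp i := by
    intro i
    have : (a • w).comp i = C (a : ℂ) * w.comp i := by
      rw [← smul_eq_C_mul]; rfl
    rw [this]
    exact (a.isUnit.map (C : ℂ →+* Poly)).dvd_mul_left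
  simp only [h]

/-- The foliation defined by a form without common factor. -/
def Foliation.mk {N : ℕ} (w : Form N) (hw : w.NoCommonFactor) : Foliation N :=
  ⟨Projectivization.mk ℂ w hw.ne_zero, (noCommonFactor_rep_mk w hw.ne_zero).2 hw⟩

instance (N : ℕ) : MulAction (GL (Fin 3) ℂ) (Foliation N) where
  smul g F := ⟨g • F.1, by
    obtain ⟨p, hp⟩ := F
    induction p using Projectivization.ind with
    | h w hw =>
      rw [Projectivization.smul_mk, noCommonFactor_rep_mk]
      exact ((noCommonFactor_rep_mk w hw).1 hp).smul g⟩
  one_smul F := Subtype.ext (one_smul _ F.1)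
  mul_smul g h F := Subtype.ext (mul_smul g h F.1)

/-- The action of `Aut(ℙ²(ℂ)) = PGL₃(ℂ)` on `𝓕(2; N)`. -/
instance (N : ℕ) : MulAction PGL(3, ℂ) (Foliation N) :=
  Matrix.ProjGenLinGroup.mulActionOfGL fun u => by
    rintro ⟨p, hp⟩
    refine Subtype.ext ?_
    change Matrix.GeneralLinearGroup.scalar (Fin 3) u • p = p
    induction p using Projectivization.ind with
    | h w hw =>
      rw [Projectivization.smul_mk, Projectivization.mk_eq_mk_iff]
      refine ⟨(u⁻¹) ^ (N + 2), ?_⟩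
      rw [smul_def, ← map_inv]
      exact (pullback_scalar ((u⁻¹ : ℂˣ) : ℂ) w).symm

lemma mk_smul_mk {N : ℕ} (g : GL (Fin 3) ℂ) (w : Form N) (hw : w.NoCommonFactor) :
    Matrix.ProjGenLinGroup.mk g • Foliation.mk w hw = Foliation.mk (g • w) (hw.smul g) := rfl

/-- The orbit `𝓞(F)` of a foliation under `Aut(ℙ²(ℂ)) = PGL₃(ℂ)`. -/
def orbit {N : ℕ} (F : Foliation N) : Set (Foliation N) := MulAction.orbit PGL(3, ℂ) F

/-! ### The foliations `F₁`, `F₂`, `F₃`, `F₅` -/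

/-- The expression `a(x, y, 1) dx + b(x, y, 1) dy` of a form in the affine chart `Z = 1`,
recorded as the pair of its coefficients. -/
def Form.chart {N : ℕ} (w : Form N) : Fin 2 → MvPolynomial (Fin 2) ℂ :=
  ![aeval ![X 0, X 1, 1] (w.comp 0), aeval ![X 0, X 1, 1] (w.comp 1)]

/-! The affine coordinates `x`, `y` and their differentials. -/
def x : MvPolynomial (Fin 2) ℂ := X 0

def y : MvPolynomial (Fin 2) ℂ := X 1

def dx : Fin 2 → MvPolynomial (Fin 2) ℂ := ![1, 0]

def dy : Fin 2 → MvPolynomial (Fin 2) ℂ := ![0, 1]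

/-- The homogeneous form `p (Y dX - X dY) + q (Y dZ - Z dY) + r (X dZ - Z dX)`. -/
def formOf {N : ℕ} (p q r : Poly) (hp : p.IsHomogeneous N) (hq : q.IsHomogeneous N)
    (hr : r.IsHomogeneous N) : Form N :=
  ⟨![p * X 1 - r * X 2, -(p * X 0) - q * X 2, q * X 1 + r * X 0], by
    have h0 : ∀ {s : Poly} (i : Fin 3), s.IsHomogeneous N → (s * X i).IsHomogeneous (N + 1) :=
      fun i hs => hs.mul (isHomogeneous_X ℂ i)
    intro i
    fin_cases i
    · exact (h0 1 hp).sub (h0 2 hr)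
    · exact (h0 0 hp).neg.sub (h0 2 hq)
    · exact (h0 1 hq).add (h0 0 hr), by
    simp [Fin.sum_univ_three]
    ring⟩

lemma chart_formOf {N : ℕ} (p q r : Poly) (hp : p.IsHomogeneous N) (hq : q.IsHomogeneous N)
    (hr : r.IsHomogeneous N) :
    (formOf p q r hp hq hr).chart = aeval ![x, y, 1] p • (y • dx - x • dy)
      - aeval ![x, y, 1] q • dy - aeval ![x, y, 1] r • dx := by
  funext i
  fin_cases i <;> simp [Form.chart, formOf, Form.comp, x, y, dx, dy]

lemma hom_mul (i j : Fin 3) : (X i * X j : Poly).IsHomogeneous 2 :=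
  (isHomogeneous_X ℂ i).mul (isHomogeneous_X ℂ j)

lemma hom_zero : (0 : Poly).IsHomogeneous 2 := isHomogeneous_zero _ _ _

/-- The homogenization of `x² dx + y² (x dy - y dx)`. -/
def form₁ : Form 2 :=
  formOf (-(X 1 * X 1)) 0 (-(X 0 * X 0)) (hom_mul 1 1).neg hom_zero (hom_mul 0 0).neg

/-- The homogenization of `x² dx + (x + y²) (x dy - y dx)`. -/
def form₂ : Form 2 :=
  formOf (-(X 0 * X 2 + X 1 * X 1)) 0 (-(X 0 * X 0))
    ((hom_mul 0 2).add (hom_mul 1 1)).neg hom_zero (hom_mul 0 0).neg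

/-- The homogenization of `x y dx + (x² + y²) (x dy - y dx)`. -/
def form₃ : Form 2 :=
  formOf (-(X 0 * X 0 + X 1 * X 1)) 0 (-(X 0 * X 1))
    ((hom_mul 0 0).add (hom_mul 1 1)).neg hom_zero (hom_mul 0 1).neg

/-- The homogenization of `x² dy + y² (x dy - y dx)`. -/
def form₅ : Form 2 :=
  formOf (-(X 1 * X 1)) (-(X 0 * X 0)) 0 (hom_mul 1 1).neg (hom_mul 0 0).neg hom_zero

lemma chart_form₁ : form₁.chart = x ^ 2 • dx + y ^ 2 • (x • dy - y • dx) := by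
  rw [form₁, chart_formOf]
  funext i
  fin_cases i <;> simp [dx, dy] <;> first | ring1 | (left; ring1)

lemma chart_form₂ : form₂.chart = x ^ 2 • dx + (x + y ^ 2) • (x • dy - y • dx) := by
  rw [form₂, chart_formOf]
  funext i
  fin_cases i <;> simp [dx, dy] <;> ring1

lemma chart_form₃ : form₃.chart = (x * y) • dx + (x ^ 2 + y ^ 2) • (x • dy - y • dx) := by
  rw [form₃, chart_formOf]
  funext i
  fin_cases i <;> simp [dx, dy] <;> ring1

lemma chart_form₅ : form₅.chart = x ^ 2 • dy + y ^ 2 • (x • dy - y • dx) := by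
  rw [form₅, chart_formOf]
  funext i
  fin_cases i <;> simp [dx, dy] <;> first | ring1 | (left; ring1)

lemma isRelPrime_X {i j : Fin 3} (h : i ≠ j) : IsRelPrime (X i : Poly) (X j) :=
  (MvPolynomial.X_prime (R := ℂ)).irreducible.isRelPrime_iff_not_dvd.2
    fun h' => h (MvPolynomial.X_dvd_X.1 h')

lemma noCommonFactor_form₁ : form₁.NoCommonFactor := by
  intro d hd
  obtain ⟨a, ha⟩ := hd 0
  obtain ⟨c, hc⟩ := hd 2
  simp [form₁, formOf, Form.comp] at ha hc
  have h1 : d ∣ X 0 ^ 3 :=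
    ⟨(-1) * c, by
      linear_combination (-1) * hc⟩
  have h2 : d ∣ X 1 ^ 6 :=
    ⟨(-(X 1 ^ 3) - X 0 ^ 2 * X 2) * a + (-(X 0 * X 2 ^ 2)) * c, by
      linear_combination (-(X 1 ^ 3) - X 0 ^ 2 * X 2) * ha + (-(X 0 * X 2 ^ 2)) * hc⟩
  exact (isRelPrime_X (show (0 : Fin 3) ≠ 1 by decide)).pow h1 h2

lemma noCommonFactor_form₂ : form₂.NoCommonFactor := by
  intro d hd
  obtain ⟨a, ha⟩ := hd 0
  obtain ⟨c, hc⟩ := hd 2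
  simp [form₂, formOf, Form.comp] at ha hc
  have h1 : d ∣ X 0 ^ 3 :=
    ⟨(-1) * c, by
      linear_combination (-1) * hc⟩
  have h2 : d ∣ X 1 ^ 9 :=
    ⟨(-(X 1 ^ 6 + X 1 ^ 3 * (X 0 * (X 0 * X 2 - X 1 * X 2)) + (X 0 * (X 0 * X 2 - X 1 * X 2)) ^ 2)) * a + (-(X 0 * X 2 - X 1 * X 2) ^ 3) * c, by
      linear_combination (-(X 1 ^ 6 + X 1 ^ 3 * (X 0 * (X 0 * X 2 - X 1 * X 2)) + (X 0 * (X 0 * X 2 - X 1 * X 2)) ^ 2)) * ha + (-(X 0 * X 2 - X 1 * X 2) ^ 3) * hc⟩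
  exact (isRelPrime_X (show (0 : Fin 3) ≠ 1 by decide)).pow h1 h2

lemma noCommonFactor_form₃ : form₃.NoCommonFactor := by
  intro d hd
  obtain ⟨a, ha⟩ := hd 0
  obtain ⟨b, hb⟩ := hd 1
  obtain ⟨c, hc⟩ := hd 2
  simp [form₃, formOf, Form.comp] at ha hb hc
  have h1 : d ∣ X 0 ^ 4 :=
    ⟨(X 0) * b + (X 1) * c, by
      linear_combination (X 0) * hb + (X 1) * hc⟩
  have h2 : d ∣ X 1 ^ 6 :=
    ⟨(-(X 1 ^ 3 + X 0 * X 1 * X 2)) * a + (X 1 ^ 3 + X 0 * X 1 * X 2 - X 1 * X 2 ^ 2) * c, by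
      linear_combination (-(X 1 ^ 3 + X 0 * X 1 * X 2)) * ha + (X 1 ^ 3 + X 0 * X 1 * X 2 - X 1 * X 2 ^ 2) * hc⟩
  exact (isRelPrime_X (show (0 : Fin 3) ≠ 1 by decide)).pow h1 h2

lemma noCommonFactor_form₅ : form₅.NoCommonFactor := by
  intro d hd
  obtain ⟨a, ha⟩ := hd 0
  obtain ⟨b, hb⟩ := hd 1
  obtain ⟨c, hc⟩ := hd 2
  simp [form₅, formOf, Form.comp] at ha hb hc
  have h1 : d ∣ X 1 ^ 3 :=
    ⟨(-1) * a, by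
      linear_combination (-1) * ha⟩
  have h2 : d ∣ X 0 ^ 4 * X 2 ^ 2 :=
    ⟨(X 0 ^ 2 * X 2 - X 0 * X 1 ^ 2) * b + (-(X 1 ^ 3)) * c, by
      linear_combination (X 0 ^ 2 * X 2 - X 0 * X 1 ^ 2) * hb + (-(X 1 ^ 3)) * hc⟩
  exact ((isRelPrime_X (show (1 : Fin 3) ≠ 0 by decide)).pow).mul_right
    ((isRelPrime_X (show (1 : Fin 3) ≠ 2 by decide)).pow) h1 h2

/-- The foliation given in the chart `Z = 1` by `x² dx + y² (x dy - y dx)`. -/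
def F₁ : Foliation 2 := .mk form₁ noCommonFactor_form₁

/-- The foliation given in the chart `Z = 1` by `x² dx + (x + y²) (x dy - y dx)`. -/
def F₂ : Foliation 2 := .mk form₂ noCommonFactor_form₂

/-- The foliation given in the chart `Z = 1` by `x y dx + (x² + y²) (x dy - y dx)`. -/
def F₃ : Foliation 2 := .mk form₃ noCommonFactor_form₃

/-- The foliation given in the chart `Z = 1` by `x² dy + y² (x dy - y dx)`. -/
def F₅ : Foliation 2 := .mk form₅ noCommonFactor_form₅

end PlaneFoliation

end

noncomputable section

namespace PlaneFoliation

/-! ### Continuity of the action on forms -/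

/-! The four forms share a flag: the point (0:0:1) and the invariant line X = 0. They lie in a
six-parameter family `flagForm`, stable under pullback by lower triangular matrices, which are the
matrices preserving that flag. Since every matrix becomes lower triangular after right
multiplication by a unitary one, the orbit of such a form lies in the unitary saturation of any
closed cone W of flag forms that contains its lower triangular pullbacks. The unitary group is
compact, so this saturation is closed, and every foliation in the orbit closure is given, in
suitable coordinates, by a form in W (`exists_flagForm_of_mem_closure_orbit`).

W is cut out by relations that `pullback_lowerTri_flagForm` shows to be invariant: β = γ = 0 for F₁,
β + γ = 0 for F₂, γ = 0 for F₃, and β = 0 with 2αc₂ = γc₁ for F₅. Absence of a common factor forces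
c₂ ≠ 0 and some further nonvanishing. An explicit lower triangular change of coordinates then brings
each remaining form to one of the four models. For F₁ and F₅ only the model itself occurs. For F₂
and F₃ the degenerate case β = γ = 0 also occurs and gives F₁; it is attained, by letting a
parameter t tend to 0. -/

/-- A family of polynomials all of whose coefficients depend continuously on the parameter. -/
def ContinuousCoeffs {T : Type*} [TopologicalSpace T] (f : T → Poly) : Prop :=
  ∀ m, Continuous fun t => coeff m (f t)

namespace ContinuousCoeffs

variable {T : Type*} [TopologicalSpace T] {f g : T → Poly}

lemma const (p : Poly) : ContinuousCoeffs fun _ : T => p := fun _ => continuous_const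

lemma add (hf : ContinuousCoeffs f) (hg : ContinuousCoeffs g) :
    ContinuousCoeffs fun t => f t + g t := fun m => by
  simp only [coeff_add]
  exact (hf m).add (hg m)

lemma neg (hf : ContinuousCoeffs f) : ContinuousCoeffs fun t => -f t := fun m => by
  simp only [coeff_neg]
  exact (hf m).neg

lemma sub (hf : ContinuousCoeffs f) (hg : ContinuousCoeffs g) :
    ContinuousCoeffs fun t => f t - g t := fun m => by
  simp only [coeff_sub]
  exact (hf m).sub (hg m)

lemma mul (hf : ContinuousCoeffs f) (hg : ContinuousCoeffs g) :
    ContinuousCoeffs fun t => f t * g t := fun m => by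
  classical
  simp only [coeff_mul]
  exact continuous_finsetSum _ fun i _ => (hf _).mul (hg _)

lemma sum {ι : Type*} (s : Finset ι) {f : ι → T → Poly} (hf : ∀ i ∈ s, ContinuousCoeffs (f i)) :
    ContinuousCoeffs fun t => ∑ i ∈ s, f i t := fun m => by
  simp only [coeff_sum]
  exact continuous_finsetSum _ fun i hi => hf i hi m

lemma pow (hf : ContinuousCoeffs f) (n : ℕ) : ContinuousCoeffs fun t => f t ^ n := by
  induction n with
  | zero => simpa using const 1
  | succ n ih => simpa only [pow_succ] using ih.mul hf

lemma prod {ι : Type*} (s : Finset ι) {f : ι → T → Poly} (hf : ∀ i ∈ s, ContinuousCoeffs (f i)) :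
    ContinuousCoeffs fun t => ∏ i ∈ s, f i t := by
  classical
  induction s using Finset.induction_on with
  | empty => simpa using const 1
  | insert a s ha ih =>
    simp only [Finset.prod_insert ha]
    exact (hf a (by simp)).mul (ih fun i hi => hf i (by simp [hi]))

lemma C {c : T → ℂ} (hc : Continuous c) : ContinuousCoeffs fun t => (MvPolynomial.C (c t) : Poly) :=
  fun m => by
    classical
    simp only [coeff_C]
    split_ifs
    exacts [hc, continuous_const]

end ContinuousCoeffs

lemma continuous_form_iff {N : ℕ} {T : Type*} [TopologicalSpace T] {f : T → Form N} :
    Continuous f ↔ ∀ i, ContinuousCoeffs fun t => (f t).comp i := by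
  rw [continuous_induced_rng, continuous_pi_iff]
  exact ⟨fun h i m => h (i, m), fun h q => h q.1 q.2⟩

lemma continuousCoeffs_comp {N : ℕ} (i : Fin 3) : ContinuousCoeffs fun w : Form N => w.comp i :=
  continuous_form_iff.1 continuous_id i

instance (N : ℕ) : T2Space (Form N) :=
  T2Space.of_injective_continuous
    (f := fun (w : Form N) (q : Fin 3 × (Fin 3 →₀ ℕ)) => coeff q.2 (w.comp q.1))
    (fun _ _ h => Form.ext fun i => MvPolynomial.ext _ _ fun m => congrFun h (i, m))
    continuous_induced_dom

lemma isHomogeneous_comp {N : ℕ} (w : Form N) (i : Fin 3) : (w.comp i).IsHomogeneous (N + 1) :=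
  w.2.1 i

/-- The index set depends only on the degree, unlike the support of p, so the formula can be
differentiated from p's support and used for continuity in A and p jointly. -/
lemma subst_eq_sum (A : Matrix (Fin 3) (Fin 3) ℂ) {p : Poly} {n : ℕ} (hp : p.IsHomogeneous n) :
    subst A p = ∑ d ∈ Finset.univ.finsuppAntidiag n,
      C (coeff d p) * ∏ i, (∑ k, C (A i k) * X k) ^ d i := by
  have h : p.support ⊆ Finset.univ.finsuppAntidiag n := by
    intro d hd
    have := hp (mem_support_iff.mp hd)
    rw [show Finsupp.weight (1 : Fin 3 → ℕ) d = d.degree from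
      (DFunLike.congr_fun Finsupp.degree_eq_weight_one d).symm, Finsupp.degree_eq_sum] at this
    simpa [Finset.mem_finsuppAntidiag] using this
  rw [subst, aeval_def, eval₂_eq']
  exact Finset.sum_subset h fun d _ hd => by simp [notMem_support_iff.1 hd]

lemma continuous_pullback {N : ℕ} :
    Continuous fun q : Matrix (Fin 3) (Fin 3) ℂ × Form N => pullback q.1 q.2 := by
  have hA : ∀ i k, ContinuousCoeffs
      fun q : Matrix (Fin 3) (Fin 3) ℂ × Form N => (C (q.1 i k) : Poly) := fun i k =>
    .C ((continuous_apply_apply i k).comp continuous_fst)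
  refine continuous_form_iff.2 fun j => ?_
  simp only [comp_pullback, subst_eq_sum _ (isHomogeneous_comp _ _)]
  exact .sum _ fun i _ => (hA i j).mul <| .sum _ fun d _ =>
    (ContinuousCoeffs.C ((continuousCoeffs_comp i d).comp continuous_snd)).mul <|
      .prod _ fun i _ => .pow (.sum _ fun k _ => (hA i k).mul (.const _)) _

/-! ### Saturation under the unitary group -/

lemma isCompact_unitaryGroup :
    IsCompact (Matrix.unitaryGroup (Fin 3) ℂ : Set (Matrix (Fin 3) (Fin 3) ℂ)) := by
  have hK : IsCompact (Set.univ.pi fun _ => Set.univ.pi fun _ => Metric.closedBall 0 1 :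
      Set (Fin 3 → Fin 3 → ℂ)) :=
    isCompact_univ_pi fun _ => isCompact_univ_pi fun _ => isCompact_closedBall _ _
  refine hK.of_isClosed_subset ?_ fun U hU i _ j _ => by
    simpa using entry_norm_bound_of_unitary hU i j
  have : (Matrix.unitaryGroup (Fin 3) ℂ : Set (Matrix (Fin 3) (Fin 3) ℂ))
      = {U | U * star U = 1} := Set.ext fun U => Matrix.mem_unitaryGroup_iff
  rw [this]
  exact isClosed_eq (by fun_prop) continuous_const

/-- The forms which some unitary change of coordinates sends into `W`. -/
def unitarySaturation {N : ℕ} (W : Set (Form N)) : Set (Form N) :=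
  {w | ∃ U ∈ Matrix.unitaryGroup (Fin 3) ℂ, pullback U w ∈ W}

/-- Projection along a compact factor is a closed map; the saturation is the projection of a closed
set of pairs (U, w). -/
lemma isClosed_unitarySaturation {N : ℕ} {W : Set (Form N)} (hW : IsClosed W) :
    IsClosed (unitarySaturation W) := by
  let K : Set (Matrix (Fin 3) (Fin 3) ℂ) := ↑(Matrix.unitaryGroup (Fin 3) ℂ)
  have : CompactSpace K := isCompact_iff_compactSpace.1 isCompact_unitaryGroup
  have hc : Continuous fun q : K × Form N => ((q.1 : Matrix (Fin 3) (Fin 3) ℂ), q.2) :=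
    (continuous_subtype_val.comp continuous_fst).prodMk continuous_snd
  have hcl : IsClosed {q : K × Form N | pullback q.1.1 q.2 ∈ W} :=
    hW.preimage (continuous_pullback.comp hc)
  have himg : unitarySaturation W
      = Prod.snd '' {q : K × Form N | pullback q.1.1 q.2 ∈ W} := by
    ext w
    constructor
    · rintro ⟨U, hU, h⟩
      exact ⟨(⟨U, hU⟩, w), h, rfl⟩
    · rintro ⟨⟨U, w⟩, h, rfl⟩
      exact ⟨U.1, U.2, h⟩
  rw [himg]
  exact isClosedMap_snd_of_compactSpace _ hcl

/-- Gram–Schmidt applied to the conjugated rows of g; the resulting basis gives the columns of U.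
The entry (i, j) of gU is then a Hermitian product of row i with basis vector j, which vanishes for
i < j. Invertibility of g plays no role. -/
lemma exists_unitary_mul_lowerTriangular (g : Matrix (Fin 3) (Fin 3) ℂ) :
    ∃ U ∈ Matrix.unitaryGroup (Fin 3) ℂ, ∀ i j, i < j → (g * U) i j = 0 := by
  let f : Fin 3 → EuclideanSpace ℂ (Fin 3) := fun i => WithLp.toLp 2 fun k => star (g i k)
  let b := InnerProductSpace.gramSchmidtOrthonormalBasis (𝕜 := ℂ) (by simp) f
  refine ⟨Matrix.of fun k j => b j k, ?_, fun i j hij => ?_⟩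
  · rw [Matrix.mem_unitaryGroup_iff']
    ext i j
    have := b.inner_eq_ite i j
    rw [Matrix.one_apply, ← this]
    simp [Matrix.mul_apply, Matrix.star_apply, PiLp.inner_apply, mul_comm]
  · have := InnerProductSpace.gramSchmidtOrthonormalBasis_inv_triangular (𝕜 := ℂ)
      (by simp : Module.finrank ℂ (EuclideanSpace ℂ (Fin 3)) = Fintype.card (Fin 3)) f hij
    rw [← inner_conj_symm, map_eq_zero] at this
    rw [← this]
    simp [Matrix.mul_apply, PiLp.inner_apply, f, b, mul_comm]

/-! ### Foliations defined by forms in a closed cone -/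

lemma Foliation.mk_rep {N : ℕ} (F : Foliation N) : Foliation.mk F.1.rep F.2 = F :=
  Subtype.ext F.1.mk_rep

/-- The representative is an arbitrary choice up to a unit, so the cone condition makes membership
independent of it; the quotient topology does the rest. -/
lemma isClosed_setOf_rep_mem {N : ℕ} {T : Set (Form N)} (hT : IsClosed T)
    (hc : ∀ (c : ℂˣ), ∀ w ∈ T, c • w ∈ T) : IsClosed {F : Foliation N | F.1.rep ∈ T} := by
  have h : IsClosed {p : ℙ ℂ (Form N) | p.rep ∈ T} := by
    rw [isClosed_coinduced]
    convert hT.preimage (continuous_subtype_val (p := fun v : Form N => v ≠ 0)) using 1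
    ext v
    obtain ⟨c, hv⟩ := Projectivization.exists_smul_eq_mk_rep ℂ v.1 v.2
    change (Projectivization.mk ℂ v.1 v.2).rep ∈ T ↔ v.1 ∈ T
    rw [← hv]
    exact ⟨fun h => by simpa using hc c⁻¹ _ h, hc c _⟩
  exact h.preimage continuous_subtype_val

/-- The group acts by push-forward, so g carries the class of w to that of v exactly when pulling v
back by g gives a multiple of w. -/
lemma mk_mem_orbit_iff {N : ℕ} {v w : Form N} (hv : v.NoCommonFactor) (hw : w.NoCommonFactor) :
    Foliation.mk v hv ∈ orbit (Foliation.mk w hw) ↔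
      ∃ (g : GL (Fin 3) ℂ) (c : ℂˣ), pullback g.1 v = c • w := by
  have key : ∀ g : GL (Fin 3) ℂ, Matrix.ProjGenLinGroup.mk g • Foliation.mk w hw
      = Foliation.mk v hv ↔ ∃ c : ℂˣ, pullback g.1 v = c • w := by
    intro g
    rw [mk_smul_mk, Subtype.ext_iff]
    have h1 : pullback g.1 v = g⁻¹ • v := by rw [smul_def, inv_inv]
    change Projectivization.mk ℂ _ _ = Projectivization.mk ℂ _ _ ↔ _
    rw [eq_comm, Projectivization.mk_eq_mk_iff]
    refine exists_congr fun c => ?_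
    rw [h1, inv_smul_eq_iff]
    have h2 : g • c • w = c • g • w := smul_comm g (c : ℂ) w
    rw [h2, eq_comm]
  constructor
  · rintro ⟨q, hq⟩
    obtain ⟨g, rfl⟩ := Matrix.ProjGenLinGroup.mk_surjective q
    exact ⟨g, (key g).1 hq⟩
  · rintro ⟨g, hg⟩
    exact ⟨_, (key g).2 hg⟩

lemma noCommonFactor_pullback_iff {N : ℕ} (g : GL (Fin 3) ℂ) {w : Form N} :
    (pullback g.1 w).NoCommonFactor ↔ w.NoCommonFactor := by
  have h1 : pullback g.1 w = g⁻¹ • w := by rw [smul_def, inv_inv]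
  rw [h1]
  exact ⟨fun h => by simpa using h.smul g, fun h => h.smul _⟩

/-! ### Forms adapted to the flag `(0 : 0 : 1) ∈ {X = 0}` -/

lemma hom_smul_mul (c : ℂ) (i j : Fin 3) : (C c * (X i * X j) : Poly).IsHomogeneous 2 := by
  simpa using (isHomogeneous_C (Fin 3) c).mul (hom_mul i j)

/-- The homogenization of
`x (α x + β y) dx + γ x² dy + (c₀ x² + c₁ x y + c₂ y²) (x dy - y dx)`. -/
def flagForm (α β γ c₀ c₁ c₂ : ℂ) : Form 2 :=
  formOf (-(C c₀ * (X 0 * X 0) + C c₁ * (X 0 * X 1) + C c₂ * (X 1 * X 1)))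
    (-(C γ * (X 0 * X 0))) (-(C α * (X 0 * X 0) + C β * (X 0 * X 1)))
    (((hom_smul_mul _ _ _).add (hom_smul_mul _ _ _)).add (hom_smul_mul _ _ _)).neg
    (hom_smul_mul _ _ _).neg ((hom_smul_mul _ _ _).add (hom_smul_mul _ _ _)).neg

section comp

variable (α β γ c₀ c₁ c₂ : ℂ)

lemma comp_flagForm_zero : (flagForm α β γ c₀ c₁ c₂).comp 0 =
    (C α * (X 0 * X 0) + C β * (X 0 * X 1)) * X 2
      - (C c₀ * (X 0 * X 0) + C c₁ * (X 0 * X 1) + C c₂ * (X 1 * X 1)) * X 1 := by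
  simp [flagForm, formOf, Form.comp]; ring

lemma comp_flagForm_one : (flagForm α β γ c₀ c₁ c₂).comp 1 =
    C γ * (X 0 * X 0) * X 2
      + (C c₀ * (X 0 * X 0) + C c₁ * (X 0 * X 1) + C c₂ * (X 1 * X 1)) * X 0 := by
  simp [flagForm, formOf, Form.comp]; ring

lemma comp_flagForm_two : (flagForm α β γ c₀ c₁ c₂).comp 2 =
    -(C γ * (X 0 * X 0) * X 1 + (C α * (X 0 * X 0) + C β * (X 0 * X 1)) * X 0) := by
  simp [flagForm, formOf, Form.comp]; ring

end comp

lemma form₁_eq : form₁ = flagForm 1 0 0 0 0 1 := by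
  refine Form.ext fun i => ?_
  fin_cases i <;> simp [form₁, flagForm, formOf, Form.comp]

lemma form₂_eq : form₂ = flagForm 1 (-1) 1 0 0 1 := by
  refine Form.ext fun i => ?_
  fin_cases i <;> simp [form₂, flagForm, formOf, Form.comp] <;> ring

lemma form₃_eq : form₃ = flagForm 0 1 0 1 0 1 := by
  refine Form.ext fun i => ?_
  fin_cases i <;> simp [form₃, flagForm, formOf, Form.comp]

lemma form₅_eq : form₅ = flagForm 0 0 1 0 0 1 := by
  refine Form.ext fun i => ?_
  fin_cases i <;> simp [form₅, flagForm, formOf, Form.comp]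

lemma smul_flagForm (k α β γ c₀ c₁ c₂ : ℂ) :
    k • flagForm α β γ c₀ c₁ c₂
      = flagForm (k * α) (k * β) (k * γ) (k * c₀) (k * c₁) (k * c₂) := by
  refine Form.ext fun i => ?_
  rw [Form.comp_smul, smul_eq_C_mul]
  fin_cases i <;>
  · simp only [Fin.zero_eta, Fin.mk_one, Fin.reduceFinMk, comp_flagForm_zero, comp_flagForm_one,
      comp_flagForm_two, C_mul]
    ring

/-- The lower triangular matrices, i.e. the linear maps preserving the flag. -/
def lowerTri (a b s c p q : ℂ) : Matrix (Fin 3) (Fin 3) ℂ := !![a, 0, 0; c, b, 0; p, q, s]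

/-- The formulas exhibit the invariants: β and γ are scaled by the same factor a²bs, and c₂ by ab³.
When β = 0, the quantity 2αc₂ - γc₁ is scaled by a⁴b³s. -/
lemma pullback_lowerTri_flagForm (a b s c p q α β γ c₀ c₁ c₂ : ℂ) :
    pullback (lowerTri a b s c p q) (flagForm α β γ c₀ c₁ c₂) = flagForm
      ((α * a ^ 2 + β * a * c) * a * s + γ * a ^ 2 * s * c) (β * b * a ^ 2 * s)
      (γ * a ^ 2 * s * b)
      (a * b * (c₀ * a ^ 2 + c₁ * a * c + c₂ * c ^ 2) - a * q * (α * a ^ 2 + β * a * c)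
        + (p * b - c * q) * (γ * a ^ 2))
      (a * b * (c₁ * a * b + 2 * c₂ * c * b) - a * q * (β * a * b)) (a * b ^ 3 * c₂) := by
  refine Form.ext fun i => ?_
  rw [comp_pullback, Fin.sum_univ_three]
  have h0 : subst (lowerTri a b s c p q) (X 0) = C a * X 0 := by
    simp [subst_X, lowerTri, Fin.sum_univ_three]
  have h1 : subst (lowerTri a b s c p q) (X 1) = C c * X 0 + C b * X 1 := by
    simp [subst_X, lowerTri, Fin.sum_univ_three]
  have h2 : subst (lowerTri a b s c p q) (X 2) = C p * X 0 + C q * X 1 + C s * X 2 := by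
    simp [subst_X, lowerTri, Fin.sum_univ_three]
  simp only [comp_flagForm_zero, comp_flagForm_one, comp_flagForm_two, map_add, map_sub, map_neg,
    map_mul, h0, h1, h2, subst_C]
  fin_cases i <;>
  · simp only [Fin.zero_eta, Fin.mk_one, Fin.reduceFinMk, comp_flagForm_zero, comp_flagForm_one,
      comp_flagForm_two, C_mul, C_add, C_sub, C_pow, lowerTri, Matrix.of_apply, Matrix.cons_val',
      Matrix.cons_val_zero, Matrix.cons_val_one, Matrix.cons_val, map_zero, map_ofNat]
    ring

lemma det_lowerTri (a b s c p q : ℂ) : (lowerTri a b s c p q).det = a * b * s := by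
  simp [lowerTri, Matrix.det_fin_three]

lemma exists_unitary_pullback_eq (g : Matrix (Fin 3) (Fin 3) ℂ) :
    ∃ U ∈ Matrix.unitaryGroup (Fin 3) ℂ, ∃ a b s c p q, g * U = lowerTri a b s c p q := by
  obtain ⟨U, hU, h⟩ := exists_unitary_mul_lowerTriangular g
  refine ⟨U, hU, (g * U) 0 0, (g * U) 1 1, (g * U) 2 2, (g * U) 1 0, (g * U) 2 0, (g * U) 2 1, ?_⟩
  generalize g * U = M at *
  ext i j
  fin_cases i <;> fin_cases j <;> simp [lowerTri, h]

/-! ### Coordinates on the space of flag forms, and closed families. -/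

lemma continuous_flagForm {T : Type*} [TopologicalSpace T] {α β γ c₀ c₁ c₂ : T → ℂ}
    (hα : Continuous α) (hβ : Continuous β) (hγ : Continuous γ) (h₀ : Continuous c₀)
    (h₁ : Continuous c₁) (h₂ : Continuous c₂) :
    Continuous fun t => flagForm (α t) (β t) (γ t) (c₀ t) (c₁ t) (c₂ t) := by
  have hm : ∀ {c : T → ℂ} (p : Poly), Continuous c → ContinuousCoeffs fun t => C (c t) * p :=
    fun p hc => (ContinuousCoeffs.C hc).mul (.const p)
  refine continuous_form_iff.2 fun i => ?_
  fin_cases i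
  · simp only [Fin.zero_eta, comp_flagForm_zero]
    exact (((hm _ hα).add (hm _ hβ)).mul (.const _)).sub
      ((((hm _ h₀).add (hm _ h₁)).add (hm _ h₂)).mul (.const _))
  · simp only [Fin.mk_one, comp_flagForm_one]
    exact ((hm _ hγ).mul (.const _)).add
      ((((hm _ h₀).add (hm _ h₁)).add (hm _ h₂)).mul (.const _))
  · simp only [Fin.reduceFinMk, comp_flagForm_two]
    exact (((hm _ hγ).mul (.const _)).add
      (((hm _ hα).add (hm _ hβ)).mul (.const _))).neg

/-- The exponent of `X ^ i * Y ^ j * Z ^ k`. -/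
def expo (i j k : ℕ) : Fin 3 →₀ ℕ := Finsupp.equivFunOnFinite.symm ![i, j, k]

lemma expo_inj {i j k i' j' k' : ℕ} : expo i j k = expo i' j' k' ↔ i = i' ∧ j = j' ∧ k = k' := by
  simp [expo, Matrix.vecCons_inj]

lemma C_mul_X_pow_eq_monomial (c : ℂ) (i j k : ℕ) :
    (C c * (X 0 ^ i * X 1 ^ j * X 2 ^ k) : Poly) = monomial (expo i j k) c := by
  rw [monomial_eq, Finsupp.prod_fintype _ _ (by simp), Fin.prod_univ_three]
  simp [expo]

/-- The six coefficients of a form which determine it when it is of the shape `flagForm`. -/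
def flagCoeff (w : Form 2) : Fin 6 → ℂ :=
  ![coeff (expo 2 0 1) (w.comp 0), coeff (expo 1 1 1) (w.comp 0), coeff (expo 2 0 1) (w.comp 1),
    coeff (expo 3 0 0) (w.comp 1), coeff (expo 2 1 0) (w.comp 1), coeff (expo 1 2 0) (w.comp 1)]

lemma continuous_flagCoeff (i : Fin 6) : Continuous fun w => flagCoeff w i := by
  fin_cases i <;> exact continuousCoeffs_comp _ _

lemma flagCoeff_flagForm (α β γ c₀ c₁ c₂ : ℂ) :
    flagCoeff (flagForm α β γ c₀ c₁ c₂) = ![α, β, γ, c₀, c₁, c₂] := by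
  have e0 : (flagForm α β γ c₀ c₁ c₂).comp 0 = monomial (expo 2 0 1) α + monomial (expo 1 1 1) β
      - (monomial (expo 2 1 0) c₀ + monomial (expo 1 2 0) c₁ + monomial (expo 0 3 0) c₂) := by
    simp only [← C_mul_X_pow_eq_monomial, comp_flagForm_zero]; ring
  have e1 : (flagForm α β γ c₀ c₁ c₂).comp 1 = monomial (expo 2 0 1) γ +
      (monomial (expo 3 0 0) c₀ + monomial (expo 2 1 0) c₁ + monomial (expo 1 2 0) c₂) := by
    simp only [← C_mul_X_pow_eq_monomial, comp_flagForm_one]; ring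
  classical
  simp [flagCoeff, e0, e1, coeff_monomial, expo_inj]

/-- The flag forms are the fixed points of the continuous map sending w to the flag form with
parameters `flagCoeff w`, and fixed points form a closed set in a Hausdorff space. -/
lemma isClosed_setOf_flagForm {S : Set (Fin 6 → ℂ)} (hS : IsClosed S) :
    IsClosed {w | ∃ v ∈ S, w = flagForm (v 0) (v 1) (v 2) (v 3) (v 4) (v 5)} := by
  have hc := continuous_flagCoeff
  have : {w | ∃ v ∈ S, w = flagForm (v 0) (v 1) (v 2) (v 3) (v 4) (v 5)} =
      flagCoeff ⁻¹' S ∩ {w | w = flagForm (flagCoeff w 0) (flagCoeff w 1) (flagCoeff w 2)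
        (flagCoeff w 3) (flagCoeff w 4) (flagCoeff w 5)} := by
    ext w
    constructor
    · rintro ⟨v, hv, rfl⟩
      have : flagCoeff (flagForm (v 0) (v 1) (v 2) (v 3) (v 4) (v 5)) = v := by
        rw [flagCoeff_flagForm]
        ext i
        fin_cases i <;> rfl
      exact ⟨by rwa [Set.mem_preimage, this], by rw [Set.mem_ofPred_eq, this]⟩
    · rintro ⟨h, h'⟩
      exact ⟨_, h, h'⟩
  rw [this]
  exact (hS.preimage (continuous_pi hc)).inter <| isClosed_eq continuous_id <|
    continuous_flagForm (hc _) (hc _) (hc _) (hc _) (hc _) (hc _)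

/-! ### Reduced flag forms -/

lemma not_isUnit_of_constantCoeff {d : Poly} (h : constantCoeff d = 0) : ¬ IsUnit d :=
  fun hd => by simpa [h] using hd.map (constantCoeff (R := ℂ) (σ := Fin 3))

/-- If c₂ = 0, then X divides all three coefficients. -/
lemma Form.NoCommonFactor.flagForm_ne_zero {α β γ c₀ c₁ c₂ : ℂ}
    (h : (flagForm α β γ c₀ c₁ c₂).NoCommonFactor) : c₂ ≠ 0 := by
  rintro rfl
  refine not_isUnit_of_constantCoeff (d := X 0) (by simp) (h _ fun i => ?_)
  fin_cases i <;>
    simp only [Fin.zero_eta, Fin.mk_one, Fin.reduceFinMk, comp_flagForm_zero, comp_flagForm_one,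
      comp_flagForm_two, C_0]
  · exact ⟨(C α * X 0 + C β * X 1) * X 2 - (C c₀ * X 0 + C c₁ * X 1) * X 1, by ring⟩
  · exact ⟨C γ * X 0 * X 2 + (C c₀ * (X 0 * X 0) + C c₁ * (X 0 * X 1)), by ring⟩
  · exact ⟨-(C γ * X 0 * X 1 + (C α * (X 0 * X 0) + C β * (X 0 * X 1))), by ring⟩

/-- A flag form with vanishing tangent cone is a multiple of `X dY - Y dX`. -/
lemma Form.NoCommonFactor.flagForm_ne_zero_of_add {α β γ c₀ c₁ c₂ : ℂ}
    (h : (flagForm α β γ c₀ c₁ c₂).NoCommonFactor) (hβ : β + γ = 0) : α ≠ 0 := by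
  rintro rfl
  obtain rfl : β = -γ := eq_neg_of_add_eq_zero_left hβ
  refine not_isUnit_of_constantCoeff (d := C γ * (X 0 * X 2) +
    (C c₀ * (X 0 * X 0) + C c₁ * (X 0 * X 1) + C c₂ * (X 1 * X 1))) (by simp) (h _ fun i => ?_)
  fin_cases i <;>
    simp only [Fin.zero_eta, Fin.mk_one, Fin.reduceFinMk, comp_flagForm_zero, comp_flagForm_one,
      comp_flagForm_two, C_0, C_neg]
  · exact ⟨-X 1, by ring⟩
  · exact ⟨X 0, by ring⟩
  · exact ⟨0, by ring⟩

/-- The expression is the value of c₀x² + c₁xy + c₂y² at (β, -α). If it vanishes, αX + βY divides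
this quadratic form, hence all coefficients of the 1-form. -/
lemma Form.NoCommonFactor.flagForm_tangent_ne_zero {α β c₀ c₁ c₂ : ℂ} (hβ : β ≠ 0)
    (h : (flagForm α β 0 c₀ c₁ c₂).NoCommonFactor) :
    c₀ * β ^ 2 - c₁ * α * β + c₂ * α ^ 2 ≠ 0 := by
  intro h0
  obtain rfl : c₀ = (c₁ * α * β - c₂ * α ^ 2) / β ^ 2 := by
    rw [eq_div_iff (pow_ne_zero 2 hβ)]
    linear_combination h0
  obtain ⟨e, rfl⟩ : ∃ e, α = e * β := ⟨α / β, by field_simp⟩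
  -- With this value of c₀ the quadratic form factors as (eX + Y)((c₁ - ec₂)X + c₂Y).
  have hc : (c₁ * (e * β) * β - c₂ * (e * β) ^ 2) / β ^ 2 = e * (c₁ - e * c₂) := by
    field_simp
  rw [hc] at h
  refine not_isUnit_of_constantCoeff (d := C e * X 0 + X 1) (by simp) (h _ fun i => ?_)
  fin_cases i <;>
    simp only [Fin.zero_eta, Fin.mk_one, Fin.reduceFinMk, comp_flagForm_zero, comp_flagForm_one,
      comp_flagForm_two, C_0, C_mul, C_sub]
  · exact ⟨C β * X 0 * X 2 - ((C c₁ - C e * C c₂) * X 0 + C c₂ * X 1) * X 1, by ring⟩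
  · exact ⟨((C c₁ - C e * C c₂) * X 0 + C c₂ * X 1) * X 0, by ring⟩
  · exact ⟨-(C β * X 0 * X 0), by ring⟩

/-! ### Normalization of flag forms -/

/-- `v` and `w` define the same foliation up to a linear change of coordinates. -/
def FormEquiv {N : ℕ} (v w : Form N) : Prop :=
  ∃ (g : GL (Fin 3) ℂ) (c : ℂˣ), pullback g.1 v = c • w

lemma formEquiv_of_lowerTri {a b s c p q k : ℂ} (ha : a ≠ 0) (hb : b ≠ 0) (hs : s ≠ 0)
    (hk : k ≠ 0) {v w : Form 2} (h : pullback (lowerTri a b s c p q) v = k • w) :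
    FormEquiv v w :=
  ⟨Matrix.GeneralLinearGroup.mkOfDetNeZero (lowerTri a b s c p q)
    (by rw [det_lowerTri]; exact mul_ne_zero (mul_ne_zero ha hb) hs), Units.mk0 k hk, h⟩

lemma formEquiv_form₁ {α c₀ c₁ c₂ : ℂ} (hα : α ≠ 0) (h₂ : c₂ ≠ 0) :
    FormEquiv (flagForm α 0 0 c₀ c₁ c₂) form₁ := by
  -- The entry c completes the square and kills c₁, q removes the remaining c₀, and s equalizes α
  -- and c₂.
  refine formEquiv_of_lowerTri (a := 1) (b := 1) (s := c₂ / α) (c := -c₁ / (2 * c₂)) (p := 0)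
    (q := (c₀ - c₁ ^ 2 / (4 * c₂)) / α) one_ne_zero one_ne_zero (div_ne_zero h₂ hα) h₂ ?_
  rw [pullback_lowerTri_flagForm, form₁_eq, smul_flagForm]
  congr 1 <;> field_simp <;> ring

lemma formEquiv_form₂ {α γ c₀ c₁ c₂ : ℂ} (hα : α ≠ 0) (hγ : γ ≠ 0) (h₂ : c₂ ≠ 0) :
    FormEquiv (flagForm α (-γ) γ c₀ c₁ c₂) form₂ := by
  -- Here b makes the new α and γ equal, s matches them with c₂, then q kills c₁ and p kills c₀.
  refine formEquiv_of_lowerTri (a := 1) (b := α / γ) (s := (α / γ) ^ 3 * c₂ / α) (c := 0)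
    (p := -(c₀ + c₁ * α / γ) / γ)
    (q := -(c₁ * α / γ ^ 2)) (k := (α / γ) ^ 3 * c₂) one_ne_zero (by positivity)
    (by positivity) (by positivity) ?_
  rw [pullback_lowerTri_flagForm, form₂_eq, smul_flagForm]
  congr 1 <;> field_simp <;> ring

lemma formEquiv_form₃ {α β c₀ c₁ c₂ : ℂ} (hβ : β ≠ 0) (h₂ : c₂ ≠ 0)
    (h₀ : c₀ * β ^ 2 - c₁ * α * β + c₂ * α ^ 2 ≠ 0) :
    FormEquiv (flagForm α β 0 c₀ c₁ c₂) form₃ := by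
  -- After c has killed α, the new c₀ and c₂ agree exactly when a² has this value.
  obtain ⟨a, ha⟩ := IsAlgClosed.exists_pow_nat_eq
    (c₂ * β ^ 2 / (c₀ * β ^ 2 - c₁ * α * β + c₂ * α ^ 2)) two_pos
  have ha0 : a ≠ 0 := by
    rintro rfl
    rw [zero_pow two_ne_zero, eq_comm] at ha
    exact (by positivity : c₂ * β ^ 2 / (c₀ * β ^ 2 - c₁ * α * β + c₂ * α ^ 2) ≠ 0) ha
  have ha' : a ^ 2 * (c₀ * β ^ 2 - c₁ * α * β + c₂ * α ^ 2) = c₂ * β ^ 2 := by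
    rw [ha, div_mul_cancel₀ _ h₀]
  refine formEquiv_of_lowerTri (a := a) (b := 1) (s := c₂ / (a * β)) (c := -(α * a / β)) (p := 0)
    (q := (c₁ - 2 * c₂ * α / β) / β) (k := a * c₂) ha0 one_ne_zero (by positivity)
    (by positivity) ?_
  rw [pullback_lowerTri_flagForm, form₃_eq, smul_flagForm]
  congr 1 <;> field_simp
  · ring
  · ring
  · linear_combination β * ha'
  · ring

/-- The relation h says that the shear c = -α/γ, which kills α, kills c₁ as well; p then removes c₀.
-/
lemma formEquiv_form₅ {α γ c₀ c₁ c₂ : ℂ} (hγ : γ ≠ 0) (h₂ : c₂ ≠ 0)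
    (h : 2 * α * c₂ = γ * c₁) : FormEquiv (flagForm α 0 γ c₀ c₁ c₂) form₅ := by
  obtain rfl : c₁ = 2 * α * c₂ / γ := by rw [h]; field_simp
  refine formEquiv_of_lowerTri (a := 1) (b := 1) (s := c₂ / γ) (c := -(α / γ))
    (p := (c₂ * α ^ 2 / γ ^ 2 - c₀) / γ) (q := 0) (k := c₂) one_ne_zero one_ne_zero (by positivity)
    (by positivity) ?_
  rw [pullback_lowerTri_flagForm, form₅_eq, smul_flagForm]
  congr 1 <;> field_simp <;> ring

/-! ### Closures of orbits -/

lemma mem_orbit_of_formEquiv {N : ℕ} {v w : Form N} {F : Foliation N} (hw : w.NoCommonFactor)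
    {g : GL (Fin 3) ℂ} (hg : pullback g.1 F.1.rep = v) (h : FormEquiv v w) :
    F ∈ orbit (Foliation.mk w hw) := by
  obtain ⟨g', c, h⟩ := h
  rw [← F.mk_rep, mk_mem_orbit_iff]
  exact ⟨g * g', c, by rw [Units.val_mul, pullback_mul, hg, h]⟩

lemma pullback_smul {N : ℕ} (A : Matrix (Fin 3) (Fin 3) ℂ) (c : ℂ) (w : Form N) :
    pullback A (c • w) = c • pullback A w := Form.ext fun j => by
  simp only [comp_pullback, Form.comp_smul, map_smul, mul_smul_comm, Finset.smul_sum]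

/-- Let `S` be a closed cone of parameters such that the flag forms with parameters in `S` contain
the images of `w` under lower triangular matrices. Then each foliation in the closure of the orbit
of `w` is given, in suitable coordinates, by such a flag form. -/
lemma exists_flagForm_of_mem_closure_orbit {S : Set (Fin 6 → ℂ)} (hS : IsClosed S)
    (hc : ∀ (c : ℂ), ∀ v ∈ S, c • v ∈ S) {w : Form 2} (hw : w.NoCommonFactor)
    (htri : ∀ a b s c p q, ∃ v ∈ S, pullback (lowerTri a b s c p q) w
      = flagForm (v 0) (v 1) (v 2) (v 3) (v 4) (v 5))
    {F : Foliation 2} (hF : F ∈ closure (orbit (Foliation.mk w hw))) :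
    ∃ v ∈ S, (flagForm (v 0) (v 1) (v 2) (v 3) (v 4) (v 5)).NoCommonFactor ∧
      ∃ g : GL (Fin 3) ℂ,
        pullback g.1 F.1.rep = flagForm (v 0) (v 1) (v 2) (v 3) (v 4) (v 5) := by
  set W := {w | ∃ v ∈ S, w = flagForm (v 0) (v 1) (v 2) (v 3) (v 4) (v 5)} with hW
  have hcone : ∀ (c : ℂ), ∀ u ∈ W, c • u ∈ W := by
    rintro c _ ⟨v, hv, rfl⟩
    exact ⟨c • v, hc c v hv, smul_flagForm ..⟩
  have hcone' : ∀ (c : ℂˣ), ∀ u ∈ unitarySaturation W, c • u ∈ unitarySaturation W := by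
    rintro c u ⟨U, hU, h⟩
    refine ⟨U, hU, ?_⟩
    rw [Units.smul_def, pullback_smul]
    exact hcone c _ h
  have hsub : orbit (Foliation.mk w hw) ⊆ {F | F.1.rep ∈ unitarySaturation W} := by
    rintro F hF
    rw [← F.mk_rep, mk_mem_orbit_iff] at hF
    obtain ⟨g, c, h⟩ := hF
    have h' : F.1.rep = c • pullback (g⁻¹).1 w := by
      rw [Units.smul_def, ← pullback_smul, ← Units.smul_def, ← h, ← pullback_mul, ← Units.val_mul,
        mul_inv_cancel, Units.val_one, pullback_one]
    obtain ⟨U, hU, a, b, s, e, p, q, hT⟩ := exists_unitary_pullback_eq (g⁻¹).1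
    obtain ⟨v, hv, hv'⟩ := htri a b s e p q
    rw [Set.mem_ofPred_eq, h']
    -- Pulling (g⁻¹)^* w back by U amounts to pulling w back by the lower triangular matrix g⁻¹U, so
    -- `htri` applies.
    exact hcone' c _ ⟨U, hU, v, hv, by rw [← pullback_mul, hT, hv']⟩
  obtain ⟨U, hU, v, hv, h⟩ := closure_minimal hsub
    (isClosed_setOf_rep_mem (isClosed_unitarySaturation (isClosed_setOf_flagForm hS)) hcone') hF
  let g : GL (Fin 3) ℂ := Unitary.toUnits ⟨U, hU⟩
  exact ⟨v, hv, by rw [← h]; exact (noCommonFactor_pullback_iff g).2 F.2, g, h⟩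

lemma continuous_foliation_mk {N : ℕ} {T : Type*} [TopologicalSpace T] {u : T → Form N}
    (hu : Continuous u) (hred : ∀ t, (u t).NoCommonFactor) :
    Continuous fun t => Foliation.mk (u t) (hred t) := by
  have h1 : Continuous (Projectivization.mk' ℂ : {v : Form N // v ≠ 0} → ℙ ℂ (Form N)) :=
    continuous_coinduced_rng
  have h2 : Continuous fun t => (⟨u t, (hred t).ne_zero⟩ : {v : Form N // v ≠ 0}) :=
    hu.subtype_mk _
  exact Continuous.subtype_mk (h1.comp h2) _

lemma continuous_smul_form {N : ℕ} (g : GL (Fin 3) ℂ) : Continuous fun w : Form N => g • w := by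
  have h : Continuous fun w : Form N => ((↑g⁻¹ : Matrix (Fin 3) (Fin 3) ℂ), w) :=
    continuous_const.prodMk continuous_id
  have h' := (continuous_pullback (N := N)).comp h
  simp only [smul_def]
  exact h'

/-- If `w` is a limit of forms in the orbit of `w'`, then the orbit of `w` lies in the closure of
that of `w'`. -/
lemma orbit_subset_closure_orbit {N : ℕ} {w w' : Form N} (hw : w.NoCommonFactor)
    (hw' : w'.NoCommonFactor) {u : ℂ → Form N} (hu : Continuous u) (hu0 : u 0 = w)
    (h : ∀ t ≠ 0, FormEquiv (u t) w') :
    orbit (Foliation.mk w hw) ⊆ closure (orbit (Foliation.mk w' hw')) := by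
  have hred : ∀ t, (u t).NoCommonFactor := by
    intro t
    by_cases ht : t = 0
    · rwa [ht, hu0]
    · obtain ⟨g, c, h⟩ := h t ht
      rw [← noCommonFactor_pullback_iff g, h,
        ← noCommonFactor_rep_mk _ ((smul_ne_zero_iff_ne c).2 hw'.ne_zero)]
      have : Projectivization.mk ℂ (c • w') ((smul_ne_zero_iff_ne c).2 hw'.ne_zero)
          = Projectivization.mk ℂ w' hw'.ne_zero :=
        (Projectivization.mk_eq_mk_iff ..).2 ⟨c, rfl⟩
      rwa [this, noCommonFactor_rep_mk]
  rintro _ ⟨q, rfl⟩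
  obtain ⟨g, rfl⟩ := Matrix.ProjGenLinGroup.mk_surjective q
  have hmem : ∀ t ≠ 0, Foliation.mk (g • u t) ((hred t).smul g) ∈ orbit (Foliation.mk w' hw') := by
    intro t ht
    obtain ⟨g', c, h⟩ := h t ht
    refine (mk_mem_orbit_iff _ _).2 ⟨g * g', c, ?_⟩
    have h1 : pullback g.1 (g • u t) = u t := by
      rw [smul_def, ← pullback_mul, ← Units.val_mul, inv_mul_cancel, Units.val_one, pullback_one]
    rw [Units.val_mul, pullback_mul, h1, h]
  let γ : ℂ → Foliation N := fun t => Foliation.mk (g • u t) ((hred t).smul g)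
  have hγ : Continuous γ :=
    continuous_foliation_mk ((continuous_smul_form g).comp hu) fun t => (hred t).smul g
  have h0 : γ 0 = Matrix.ProjGenLinGroup.mk g • Foliation.mk w hw := by
    rw [mk_smul_mk]
    simp only [γ, hu0]
  change Matrix.ProjGenLinGroup.mk g • Foliation.mk w hw ∈ _
  rw [← h0]
  have hd : (0 : ℂ) ∈ closure {0}ᶜ := by
    rw [(dense_compl_singleton (0 : ℂ)).closure_eq]
    trivial
  exact map_mem_closure hγ hd hmem

/-! ### The orbit closures of the four foliations. -/

lemma isClosed_orbit_F₁ : IsClosed (orbit F₁) := by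
  refine isClosed_of_closure_subset fun F hF => ?_
  obtain ⟨v, ⟨h1, h2⟩, hred, g, hg⟩ := exists_flagForm_of_mem_closure_orbit
    (S := {v | v 1 = 0 ∧ v 2 = 0})
    ((isClosed_eq (by fun_prop) (by fun_prop)).inter (isClosed_eq (by fun_prop) (by fun_prop)))
    (by rintro c v ⟨h1, h2⟩; simp [h1, h2]) noCommonFactor_form₁
    (fun a b s c p q => by
      rw [form₁_eq, pullback_lowerTri_flagForm]
      -- Unification fills the witness with the six transformed parameters.
      exact ⟨![_, _, _, _, _, _], by simp, rfl⟩) hF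
  rw [h1, h2] at hg hred
  exact mem_orbit_of_formEquiv noCommonFactor_form₁ hg
    (formEquiv_form₁ (hred.flagForm_ne_zero_of_add (by simp)) hred.flagForm_ne_zero)

lemma isClosed_orbit_F₅ : IsClosed (orbit F₅) := by
  refine isClosed_of_closure_subset fun F hF => ?_
  obtain ⟨v, ⟨h1, h2⟩, hred, g, hg⟩ := exists_flagForm_of_mem_closure_orbit
    (S := {v | v 1 = 0 ∧ 2 * v 0 * v 5 = v 2 * v 4})
    ((isClosed_eq (by fun_prop) (by fun_prop)).inter (isClosed_eq (by fun_prop) (by fun_prop)))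
    (by
      rintro c v ⟨h1, h2⟩
      refine ⟨by simp [h1], ?_⟩
      simp only [Pi.smul_apply, smul_eq_mul]
      linear_combination c ^ 2 * h2) noCommonFactor_form₅
    (fun a b s c p q => by
      rw [form₅_eq, pullback_lowerTri_flagForm]
      refine ⟨![_, _, _, _, _, _], ⟨by simp, ?_⟩, rfl⟩
      simp
      ring) hF
  rw [h1] at hg hred
  have h5 := hred.flagForm_ne_zero
  refine mem_orbit_of_formEquiv noCommonFactor_form₅ hg (formEquiv_form₅ (fun h => ?_) h5 h2)
  -- If γ = 0, the relation 2αc₂ = γc₁ with c₂ ≠ 0 gives α = 0, which is excluded since β + γ = 0.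
  -- So no degenerate limit survives.
  refine hred.flagForm_ne_zero_of_add (by simp [h]) ?_
  simpa [h, h5] using h2

lemma closure_orbit_F₂ : closure (orbit F₂) = orbit F₂ ∪ orbit F₁ := by
  refine Set.Subset.antisymm (fun F hF => ?_) (Set.union_subset subset_closure ?_)
  · obtain ⟨v, h1, hred, g, hg⟩ := exists_flagForm_of_mem_closure_orbit
      (S := {v | v 1 = -v 2}) (isClosed_eq (by fun_prop) (by fun_prop))
      (by
        rintro c v h
        simpa using congrArg (c * ·) h) noCommonFactor_form₂
      (fun a b s c p q => by
        rw [form₂_eq, pullback_lowerTri_flagForm]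
        refine ⟨![_, _, _, _, _, _], ?_, rfl⟩
        simp
        ring) hF
    rw [Set.mem_ofPred_eq] at h1
    rw [h1] at hg hred
    have h0 := hred.flagForm_ne_zero_of_add (by simp)
    have h5 := hred.flagForm_ne_zero
    -- The only degeneration is γ = 0; then β = 0 too, and the form is of type F₁.
    by_cases h2 : v 2 = 0
    · rw [h2, neg_zero] at hg
      exact .inr (mem_orbit_of_formEquiv noCommonFactor_form₁ hg (formEquiv_form₁ h0 h5))
    · exact .inl (mem_orbit_of_formEquiv noCommonFactor_form₂ hg (formEquiv_form₂ h0 h2 h5))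
  -- For t ≠ 0 this form still satisfies β = -γ ≠ 0, so it is of type F₂; at t = 0 it is `form₁`.
  · refine orbit_subset_closure_orbit _ _ (u := fun t => flagForm 1 (-t) t 0 0 1)
      (continuous_flagForm ?_ ?_ ?_ ?_ ?_ ?_) (by rw [form₁_eq, neg_zero])
      fun t ht => formEquiv_form₂ one_ne_zero ht one_ne_zero
    all_goals fun_prop

lemma closure_orbit_F₃ : closure (orbit F₃) = orbit F₃ ∪ orbit F₁ := by
  refine Set.Subset.antisymm (fun F hF => ?_) (Set.union_subset subset_closure ?_)
  · obtain ⟨v, h2, hred, g, hg⟩ := exists_flagForm_of_mem_closure_orbit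
      (S := {v | v 2 = 0}) (isClosed_eq (by fun_prop) (by fun_prop))
      (by
        rintro c v h
        simp_all) noCommonFactor_form₃
      (fun a b s c p q => by
        rw [form₃_eq, pullback_lowerTri_flagForm]
        exact ⟨![_, _, _, _, _, _], by simp, rfl⟩) hF
    rw [Set.mem_ofPred_eq] at h2
    rw [h2] at hg hred
    have h5 := hred.flagForm_ne_zero
    by_cases h1 : v 1 = 0
    · rw [h1] at hg hred
      exact .inr (mem_orbit_of_formEquiv noCommonFactor_form₁ hg
        (formEquiv_form₁ (hred.flagForm_ne_zero_of_add (by simp)) h5))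
    · exact .inl (mem_orbit_of_formEquiv noCommonFactor_form₃ hg
        (formEquiv_form₃ h1 h5 (hred.flagForm_tangent_ne_zero h1)))
  -- For t ≠ 0 the quadratic form y² takes the value 1 at (t, -1), so the form is of type F₃; at t =
  -- 0 it is `form₁`.
  · refine orbit_subset_closure_orbit _ _ (u := fun t => flagForm 1 t 0 0 0 1)
      (continuous_flagForm ?_ ?_ ?_ ?_ ?_ ?_) (by rw [form₁_eq])
      fun t ht => formEquiv_form₃ ht one_ne_zero (by simp)
    all_goals fun_prop

end PlaneFoliation

end

theorem mainTheorem11 :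
    (IsClosed (PlaneFoliation.orbit PlaneFoliation.F₁) ∧
      IsClosed (PlaneFoliation.orbit PlaneFoliation.F₅)) ∧
    closure (PlaneFoliation.orbit PlaneFoliation.F₂) =
      PlaneFoliation.orbit PlaneFoliation.F₂ ∪ PlaneFoliation.orbit PlaneFoliation.F₁ ∧
    closure (PlaneFoliation.orbit PlaneFoliation.F₃) =
      PlaneFoliation.orbit PlaneFoliation.F₃ ∪ PlaneFoliation.orbit PlaneFoliation.F₁ :=
  ⟨⟨PlaneFoliation.isClosed_orbit_F₁, PlaneFoliation.isClosed_orbit_F₅⟩,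
    PlaneFoliation.closure_orbit_F₂, PlaneFoliation.closure_orbit_F₃⟩
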